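/- Let $u[t]$ and $v[t]$, $t\in\mathbb Z$, be real-valued, zero-mean, jointly second-order stationary random processes on a probability space: they have finite second moments, and $R_{uu}[\tau]=E(u[t]u[t-\tau])$, $R_{vv}[\tau]=E(v[t]v[t-\tau])$ and $R_{uv}[\tau]=E(u[t]v[t-\tau])$ do not depend on $t$. Suppose that $u$ and $v$ are both harmonizable, that is, for $y=u$ and for $y=v$ there is a complex measure $F$ of bounded variation on $(-1/2,1/2]^2$ with $E(y[s]y[t])=\iint e^{2\pi i(\nu s-\nu' t)}\,dF(\nu,\nu')$ for all $s,t\in\mathbb Z$. Let $i,j,k$ be the quaternion units, $x[t]=u[t]+i\,v[t]$, and write $q^{*j}=\overline{-jqj}$ for a quaternion $q$, so that $(a+bi+cj+dk)^{*j}=a+bi-cj+dk$. Then there is a quaternion-valued process $X(\nu)$, $\nu\in[-1/2,1/2]$, with finite second moments and orthogonal increments, such that for every $t\in\mathbb Z$ $$x[t]=\int_{-1/2}^{1/2}dX(\nu)\,\exp(2\pi j\nu t),$$ where the integral is the mean-square limit of the sums $\sum_m (X(\nu_{m+1})-X(\nu_m))\exp(2\pi j\xi_m t)$, $\xi_m\in[\nu_m,\nu_{m+1}]$,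 over partitions of $[-1/2,1/2]$ as their mesh tends to $0$. Moreover, for $-1/2\le a\le b\le 1/2$ and $-1/2\le c\le d\le 1/2$: 1. $E(X(b)-X(a))=0$. 2. There is a countably additive quaternion-valued Borel measure $G$, the spectral density $\Gamma_{xx}(\nu)\,d\nu$ of $x$ in the generalized sense, such that $$E|X(b)-X(a)|^2+E\big[(X(b)-X(a))(X(b)-X(a))^{*j}\big]\,j=G((a,b]).$$ If the sequences $R_{uu}$, $R_{vv}$ and $R_{uv}$ are absolutely summable, then $G$ has an integrable density: there is an integrable $\Gamma_{xx}:(-1/2,1/2]\to\mathbb H$ with $G(B)=\int_B\Gamma_{xx}(\nu)\,d\nu$ for every Borel set $B\subseteq(-1/2,1/2]$. 3. The increments are two times orthogonal: if $b\le c$ or $d\le a$, then $$E\big[(X(b)-X(a))\,\overline{(X(d)-X(c))}\big]=E\big[(X(b)-X(a))\,(X(d)-X(c))^{*j}\big]=0.$$ -/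

import Mathlib

open MeasureTheory Set
open scoped Quaternion ENNReal

noncomputable section

/-- The quaternion unit `j`. -/
def quatJ : ℍ[ℝ] := ⟨0, 0, 1, 0⟩

/-- The `ℂ_i`-valued quaternion `a + i b`. -/
def quatI (a b : ℝ) : ℍ[ℝ] := ⟨a, b, 0, 0⟩

/-- The quaternion exponential `exp(j θ) = cos θ + j sin θ`. -/
def expJ (θ : ℝ) : ℍ[ℝ] := ⟨Real.cos θ, 0, Real.sin θ, 0⟩

@[simp] theorem re_quatJ : quatJ.re = 0 := rfl
@[simp] theorem imI_quatJ : quatJ.imI = 0 := rfl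
@[simp] theorem imJ_quatJ : quatJ.imJ = 1 := rfl
@[simp] theorem imK_quatJ : quatJ.imK = 0 := rfl

/-- `expJ θ` is indeed the value at `j θ` of the exponential of the algebra of quaternions. -/
theorem expJ_eq_exp (θ : ℝ) : expJ θ = NormedSpace.exp (θ • quatJ) := by
  have hre : (θ • quatJ).re = 0 := by simp
  have hn : ‖θ • quatJ‖ = |θ| := by
    have : ‖quatJ‖ = 1 := by
      have h := Quaternion.normSq_eq_norm_mul_self quatJ
      have h1 : Quaternion.normSq quatJ = 1 := by simp [Quaternion.normSq_def']
      nlinarith [norm_nonneg quatJ]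
    rw [norm_smul, this, mul_one, Real.norm_eq_abs]
  rw [Quaternion.exp_of_re_eq_zero _ hre, hn, Real.cos_abs]
  by_cases h0 : θ = 0
  · subst h0
    ext <;> simp [expJ]
  · have hs : Real.sin |θ| / |θ| * θ = Real.sin θ := by
      rcases abs_cases θ with ⟨h, _⟩ | ⟨h, _⟩ <;> rw [h]
      · field_simp
      · rw [Real.sin_neg]
        field_simp
    ext <;> simp [expJ, hs]

/-- The conjugation `q ↦ q^{*j}`, the conjugate of the involution `- j q j`; it sends
`a + b i + c j + d k` to `a + b i - c j + d k`. -/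
def starJ (q : ℍ[ℝ]) : ℍ[ℝ] := star (-(quatJ * q * quatJ))

theorem starJ_eq (q : ℍ[ℝ]) : starJ q = ⟨q.re, q.imI, -q.imJ, q.imK⟩ := by
  ext <;> simp [starJ]

variable {Ω : Type*} [MeasurableSpace Ω]

/-- The correlation `R_{yz}[t, τ] = E(y[t] z[t - τ])` of two real discrete-time processes. -/
def corrSeq (P : Measure Ω) (y z : ℤ → Ω → ℝ) (t τ : ℤ) : ℝ :=
  ∫ ω, y t ω * z (t - τ) ω ∂P

/-- The real processes `u` and `v` are jointly second-order stationary: they have finite second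
moments, constant means, and auto- and cross-correlations that depend on the lag only. -/
structure JointlyStationary (P : Measure Ω) (u v : ℤ → Ω → ℝ) : Prop where
  memLp_left : ∀ t, MemLp (u t) 2 P
  memLp_right : ∀ t, MemLp (v t) 2 P
  mean_left : ∀ s t, ∫ ω, u s ω ∂P = ∫ ω, u t ω ∂P
  mean_right : ∀ s t, ∫ ω, v s ω ∂P = ∫ ω, v t ω ∂P
  corr_left : ∀ s t τ, corrSeq P u u s τ = corrSeq P u u t τ
  corr_right : ∀ s t τ, corrSeq P v v s τ = corrSeq P v v t τ
  corr_cross : ∀ s t τ, corrSeq P u v s τ = corrSeq P u v t τ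

/-- A real discrete-time process `y` is harmonizable: it has finite second moments, and its
second-moment function is the Fourier transform
`E(y[s] y[t]) = ∫∫ exp(2 π i (ν s - ν' t)) dF(ν, ν')` of a complex measure `F` of bounded variation
on the square `(-1/2, 1/2]²` of pairs of frequencies. -/
def Harmonizable (P : Measure Ω) (y : ℤ → Ω → ℝ) : Prop :=
  (∀ t, MemLp (y t) 2 P) ∧
  ∃ F : ComplexMeasure (ℝ × ℝ), IsFiniteMeasure F.variation ∧
    ∀ s t : ℤ, ((∫ ω, y s ω * y t ω ∂P : ℝ) : ℂ) =
      VectorMeasure.integral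
        (F.restrict (Ioc (-(1 / 2) : ℝ) (1 / 2) ×ˢ Ioc (-(1 / 2) : ℝ) (1 / 2)))
        (fun p => Complex.exp (2 * Real.pi * Complex.I * (p.1 * s - p.2 * t)))
        (ContinuousLinearMap.mul ℝ ℂ)

/-- `X` is a quaternion-valued orthogonal process on `[-1/2, 1/2]`: it has finite second moments,
and its increments over non-overlapping intervals are orthogonal. -/
structure OrthogonalProcess (P : Measure Ω) (X : ℝ → Ω → ℍ[ℝ]) : Prop where
  memLp : ∀ ν ∈ Icc (-(1 / 2) : ℝ) (1 / 2), MemLp (X ν) 2 P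
  orthogonal : ∀ a b c d : ℝ, -(1 / 2) ≤ a → a ≤ b → b ≤ 1 / 2 →
    -(1 / 2) ≤ c → c ≤ d → d ≤ 1 / 2 → (b ≤ c ∨ d ≤ a) →
    ∫ ω, (X b ω - X a ω) * star (X d ω - X c ω) ∂P = 0

/-- `y = ∫_{-1/2}^{1/2} dX(ν) f(ν)` as a mean-square Fourier–Stieltjes integral: the
Riemann–Stieltjes sums `∑ (X(ν_{k+1}) - X(ν_k)) f(ξ_k)` over tagged partitions of `[-1/2, 1/2]`
converge to `y` in mean square as the mesh of the partition tends to zero. -/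
def IsMeanSquareStieltjesIntegral (P : Measure Ω) (X : ℝ → Ω → ℍ[ℝ]) (f : ℝ → ℍ[ℝ])
    (y : Ω → ℍ[ℝ]) : Prop :=
  ∀ ε > 0, ∃ δ > 0, ∀ (n : ℕ) (p ξ : ℕ → ℝ), p 0 = -(1 / 2) → p n = 1 / 2 →
    (∀ k < n, p k ≤ ξ k ∧ ξ k ≤ p (k + 1) ∧ p (k + 1) - p k < δ) →
    eLpNorm (fun ω => y ω - ∑ k ∈ Finset.range n, (X (p (k + 1)) ω - X (p k) ω) * f (ξ k)) 2 P
      < ENNReal.ofReal ε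

end

/-! ### Herglotz's theorem on the circle. -/

section Herglotz

open AddCircle Filter Topology

/-! Write a quaternion as `z + i w` with `z`, `w` in the commutative plane spanned by `1` and `j`.
Right multiplication by `exp(jθ)` is then a complex scalar acting on both components
(`quatPair_mul_expJ`), so the representation of `x = u + i v` amounts to simultaneous complex
spectral representations of `u` and `v`.

The pair `(u, v)` is a stationary sequence in `L²(P) ⊕ L²(P)`. Herglotz's theorem gives a finite
measure `μ` on the circle with Fourier coefficients `R_uu + R_vv`. Kolmogorov's isomorphism sends
the Fourier monomials `e_n` to `(u[n], v[n])`, and its components are contractions `S` and `T`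
(`exists_jointSpectralMaps`). Take `X(ν) = S 1_{(-1/2, ν]} + i T 1_{(-1/2, ν]}`. Uniform
approximation of `e_t` by step functions gives the mean-square integral.

All second moments of increments are built from `⟨S 1_A, S 1_B⟩`, `⟨T 1_A, T 1_B⟩` and `⟨S 1_A, T
1_B⟩`. By stationarity `T* S` commutes with multiplication by the `e_n`, so each of these is the
integral over `A ∩ B` of an integrable function (`exists_crossDensity`). Disjoint bands give both
orthogonality relations; equal bands give a density of `G` with respect to `μ`. Summable
correlations make `μ` absolutely continuous (`absolutelyContinuous_of_summable_fourier`), whence a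
Lebesgue density. -/

theorem integral_fourier_haarAddCircle (n : ℤ) :
    ∫ z : UnitAddCircle, fourier n z ∂haarAddCircle = if n = 0 then 1 else 0 := by
  have h := congrFun (fourierCoeff_fourier (T := 1) n) 0
  simp only [fourierCoeff, neg_zero, fourier_zero, one_smul, Pi.single_apply] at h
  rw [h]
  simp [eq_comm]

theorem ContinuousMap.integrable_of_finite {X E : Type*} [TopologicalSpace X] [CompactSpace X]
    [MeasurableSpace X] [OpensMeasurableSpace X] [NormedAddCommGroup E]
    [SecondCountableTopologyEither X E]
    (f : C(X, E)) (μ : Measure X) [IsFiniteMeasure μ] : Integrable f μ :=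
  f.continuous.integrable_of_hasCompactSupport (HasCompactSupport.of_compactSpace f)

/-- The count behind the Fejér weights; `toNat` covers the lags `|n| > N`. -/
theorem card_filter_add_mem_Ico (N n : ℤ) :
    ((Finset.Ico 0 N).filter (fun k => k + n ∈ Finset.Ico 0 N)).card = (N - |n|).toNat := by
  have : (Finset.Ico 0 N).filter (fun k => k + n ∈ Finset.Ico 0 N)
      = Finset.Ico (max 0 (-n)) (min N (N - n)) := by
    ext k
    simp only [Finset.mem_filter, Finset.mem_Ico]
    omega
  rw [this, Int.card_Ico]
  congr 1
  rcases abs_cases n with h | h <;> omega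

variable {K : Type*} [NormedAddCommGroup K] [InnerProductSpace ℂ K]

/-- The squared norm of the finite Fourier transform of `y` over `[0, N)`. -/
noncomputable def periodogram (y : ℤ → K) (N : ℕ) (z : UnitAddCircle) : ℝ :=
  ‖∑ k ∈ Finset.Ico (0 : ℤ) N, fourier (-k) z • y k‖ ^ 2

theorem continuous_periodogram (y : ℤ → K) (N : ℕ) : Continuous (periodogram y N) := by
  unfold periodogram
  have : ∀ k : ℤ, Continuous fun z : UnitAddCircle => fourier k z := fun k => (fourier k).continuous
  fun_prop

/-- Expanding the square, orthogonality of the monomials keeps only the pairs `(k, k + n)`, and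
stationarity gives them all the same inner product. -/
theorem integral_fourier_mul_periodogram {y : ℤ → K}
    (hy : ∀ m n, inner ℂ (y m) (y n) = inner ℂ (y 0) (y (n - m))) (N : ℕ) (n : ℤ) :
    ∫ z, fourier n z * (periodogram y N z : ℂ) ∂haarAddCircle
      = ((N - |n| : ℤ).toNat : ℂ) * inner ℂ (y 0) (y n) := by
  have hpt : ∀ z : UnitAddCircle, fourier n z * (periodogram y N z : ℂ)
      = ∑ k ∈ Finset.Ico (0 : ℤ) N, ∑ m ∈ Finset.Ico (0 : ℤ) N,
        fourier (n + k - m) z * inner ℂ (y k) (y m) := by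
    intro z
    have h1 : (periodogram y N z : ℂ) = inner ℂ (∑ k ∈ Finset.Ico (0 : ℤ) N, fourier (-k) z • y k)
        (∑ k ∈ Finset.Ico (0 : ℤ) N, fourier (-k) z • y k) := by
      rw [inner_self_eq_norm_sq_to_K]
      simp [periodogram]
    rw [h1, sum_inner, Finset.mul_sum]
    refine Finset.sum_congr rfl fun k _ => ?_
    rw [inner_sum, Finset.mul_sum]
    refine Finset.sum_congr rfl fun m _ => ?_
    rw [inner_smul_left, inner_smul_right, ← fourier_neg, neg_neg, sub_eq_add_neg, fourier_add,
      fourier_add]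
    ring
  have hint : ∀ k c, Integrable (fun z : UnitAddCircle => fourier k z * (c : ℂ)) haarAddCircle :=
    fun k c => ((fourier k).integrable_of_finite haarAddCircle).mul_const c
  simp_rw [hpt]
  rw [integral_finsetSum _ fun k _ => integrable_finsetSum _ fun m _ => hint _ _]
  simp_rw [integral_finsetSum (Finset.Ico (0 : ℤ) N) fun m _ => hint _ _, integral_mul_const,
    integral_fourier_haarAddCircle, ite_mul, one_mul, zero_mul]
  have h2 : ∀ k ∈ Finset.Ico (0 : ℤ) N, (∑ m ∈ Finset.Ico (0 : ℤ) N,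
      if n + k - m = 0 then inner ℂ (y k) (y m) else 0)
        = if k + n ∈ Finset.Ico (0 : ℤ) N then inner ℂ (y 0) (y n) else 0 := by
    intro k _
    have : ∀ m, (if n + k - m = 0 then inner ℂ (y k) (y m) else 0)
        = if m = k + n then inner ℂ (y 0) (y n) else 0 := by
      intro m
      by_cases h : m = k + n
      · rw [if_pos (by omega), if_pos h, hy, h, add_sub_cancel_left]
      · rw [if_neg (by omega), if_neg h]
    simp_rw [this]
    rw [Finset.sum_ite_eq']
  rw [Finset.sum_congr rfl h2, ← Finset.sum_filter, Finset.sum_const, card_filter_add_mem_Ico,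
    nsmul_eq_mul]

theorem tendsto_toNat_sub_div (n : ℤ) :
    Tendsto (fun N : ℕ => (((N + 1 : ℕ) - |n| : ℤ).toNat : ℂ) / ((N + 1 : ℕ) : ℂ)) atTop (𝓝 1) := by
  have h : Tendsto (fun N : ℕ => (1 : ℂ) - (|n| : ℤ) * ((1 : ℂ) / ((N : ℂ) + 1))) atTop (𝓝 1) := by
    simpa using (tendsto_one_div_add_atTop_nhds_zero_nat (𝕜 := ℂ)).const_mul ((|n| : ℤ) : ℂ)
      |>.const_sub 1
  refine h.congr' ?_
  filter_upwards [eventually_ge_atTop n.natAbs] with N hN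
  have h1 : ((((N + 1 : ℕ) - |n| : ℤ).toNat : ℤ) : ℂ) = (((N + 1 : ℕ) - |n| : ℤ) : ℂ) := by
    rw [Int.toNat_of_nonneg]
    rw [Int.abs_eq_natAbs]; omega
  have h2 : ((N : ℂ) + 1) ≠ 0 := by exact_mod_cast Nat.succ_ne_zero N
  rw [Int.cast_natCast] at h1
  rw [h1]
  push_cast
  field_simp

/-- **Herglotz's theorem** for the correlation sequence of a stationary sequence of vectors. -/
theorem exists_spectralMeasure {y : ℤ → K}
    (hy : ∀ m n, inner ℂ (y m) (y n) = inner ℂ (y 0) (y (n - m))) :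
    ∃ μ : Measure UnitAddCircle, IsFiniteMeasure μ ∧
      ∀ n, ∫ z, fourier n z ∂μ = inner ℂ (y 0) (y n) := by
  by_cases h0 : y 0 = 0
  · exact ⟨0, inferInstance, fun n => by simp [h0]⟩
  have hpos : 0 < ‖y 0‖ ^ 2 := by positivity
  -- Dividing by `‖y 0‖ ^ 2` makes each density a probability density; the index `N + 1` avoids
  -- division by zero.
  set d : ℕ → UnitAddCircle → ℝ := fun N z =>
    periodogram y (N + 1) z / ((N + 1 : ℕ) * ‖y 0‖ ^ 2) with hd
  have hd0 : ∀ N z, 0 ≤ d N z := fun N z => by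
    simp only [hd, periodogram]; positivity
  have hdc : ∀ N, Continuous (d N) := fun N => (continuous_periodogram y _).div_const _
  have hcoef : ∀ N n, ∫ z, d N z • fourier n z ∂haarAddCircle
      = (((N + 1 : ℕ) - |n| : ℤ).toNat : ℂ) / ((N + 1 : ℕ) : ℂ)
        * (inner ℂ (y 0) (y n) / (‖y 0‖ ^ 2 : ℝ)) := by
    intro N n
    have : ∀ z, d N z • fourier n z = fourier n z * (periodogram y (N + 1) z : ℂ)
        / ((N + 1 : ℕ) * (‖y 0‖ ^ 2 : ℝ)) := by
      intro z
      simp only [hd, Complex.real_smul]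
      push_cast
      ring
    simp_rw [this]
    rw [integral_div, integral_fourier_mul_periodogram hy]
    ring
  have hmass : ∀ N, ∫ z, d N z ∂haarAddCircle = 1 := by
    intro N
    have h := hcoef N 0
    have h1 : ((N + 1 : ℕ) : ℂ) ≠ 0 := by exact_mod_cast Nat.succ_ne_zero N
    have h2 : ((‖y 0‖ ^ 2 : ℝ) : ℂ) ≠ 0 := by exact_mod_cast hpos.ne'
    rw [inner_self_eq_norm_sq_to_K] at h
    have h3 : ((N + 1 : ℕ) - |0| : ℤ).toNat = N + 1 := by simp
    have h4 : ((‖y 0‖ : ℂ) ^ 2) / ((‖y 0‖ ^ 2 : ℝ) : ℂ) = 1 := by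
      rw [Complex.ofReal_pow] at h2 ⊢; exact div_self h2
    rw [h3, div_self h1, one_mul] at h
    simp only [fourier_zero, Complex.real_smul, mul_one] at h
    rw [integral_complex_ofReal] at h
    exact_mod_cast h.trans h4
  have hdi : ∀ N, Integrable (d N) haarAddCircle := fun N =>
    ContinuousMap.integrable_of_finite ⟨d N, hdc N⟩ haarAddCircle
  have hprob : ∀ N, IsProbabilityMeasure
      ((haarAddCircle (T := 1)).withDensity fun z => ENNReal.ofReal (d N z)) := by
    intro N
    constructor
    rw [withDensity_apply _ MeasurableSet.univ, Measure.restrict_univ,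
      ← ofReal_integral_eq_lintegral_ofReal (hdi N) (ae_of_all _ (hd0 N)), hmass,
      ENNReal.ofReal_one]
  let ρ : ℕ → ProbabilityMeasure UnitAddCircle := fun N => ⟨_, hprob N⟩
  -- Probability measures on the compact circle form a compact space, so the limit along an
  -- ultrafilter replaces a convergent subsequence.
  let F : Ultrafilter ℕ := Ultrafilter.of atTop
  have hF : (F : Filter ℕ) ≤ atTop := Ultrafilter.of_le _
  obtain ⟨μ, -, hμ⟩ := isCompact_univ.ultrafilter_le_nhds (F.map ρ) (by simp)
  have hlim : Tendsto ρ F (𝓝 μ) := hμ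
  rw [ProbabilityMeasure.tendsto_iff_forall_integral_rclike_tendsto ℂ] at hlim
  have hprobcoef : ∀ n, ∫ z, fourier n z ∂(μ : Measure UnitAddCircle)
      = inner ℂ (y 0) (y n) / (‖y 0‖ ^ 2 : ℝ) := by
    intro n
    have h1 := hlim (BoundedContinuousFunction.mkOfCompact (fourier n))
    have h2 : ∀ N, ∫ z, fourier n z ∂(ρ N : Measure UnitAddCircle)
        = (((N + 1 : ℕ) - |n| : ℤ).toNat : ℂ) / ((N + 1 : ℕ) : ℂ)
        * (inner ℂ (y 0) (y n) / (‖y 0‖ ^ 2 : ℝ)) := by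
      intro N
      rw [← hcoef]
      change ∫ z, fourier n z ∂(haarAddCircle.withDensity fun z => ENNReal.ofReal (d N z)) = _
      rw [integral_withDensity_eq_integral_toReal_smul
        (hdc N).measurable.ennreal_ofReal (by simp)]
      simp [ENNReal.toReal_ofReal (hd0 N _)]
    simp only [BoundedContinuousFunction.mkOfCompact_apply, h2] at h1
    have h3 := ((tendsto_toNat_sub_div n).mono_left hF).mul_const
      (inner ℂ (y 0) (y n) / ((‖y 0‖ ^ 2 : ℝ) : ℂ))
    rw [one_mul] at h3
    exact tendsto_nhds_unique h1 h3
  refine ⟨ENNReal.ofReal (‖y 0‖ ^ 2) • (μ : Measure UnitAddCircle),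
    Measure.smul_finite _ ENNReal.ofReal_ne_top, fun n => ?_⟩
  rw [integral_smul_measure, hprobcoef, ENNReal.toReal_ofReal hpos.le, Complex.real_smul]
  have h2 : ((‖y 0‖ ^ 2 : ℝ) : ℂ) ≠ 0 := by exact_mod_cast hpos.ne'
  field_simp

end Herglotz

/-! ### Spectral isometry, cross-densities and absolute continuity. -/

section SpectralIsometry

open AddCircle ComplexConjugate

variable (μ : Measure UnitAddCircle) [IsFiniteMeasure μ]

/-- The Fourier monomial of index `n` in `L²(μ)`. -/
noncomputable def fourierL2 (n : ℤ) : Lp ℂ 2 μ := ContinuousMap.toLp (E := ℂ) 2 μ ℂ (fourier n)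

theorem coeFn_fourierL2 (n : ℤ) : fourierL2 μ n =ᵐ[μ] fourier n :=
  ContinuousMap.coeFn_toLp μ (fourier n)

theorem dense_span_fourier :
    Dense (Submodule.span ℂ (range (@fourier 1)) : Set C(UnitAddCircle, ℂ)) :=
  (Submodule.dense_iff_topologicalClosure_eq_top).2 span_fourier_closure_eq_top

theorem dense_span_fourierL2 : Dense (Submodule.span ℂ (range (fourierL2 μ)) : Set (Lp ℂ 2 μ)) := by
  have h := (ContinuousMap.toLp_denseRange ℂ μ ℂ (p := 2)
    (by simp)).topologicalClosure_map_submodule span_fourier_closure_eq_top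
  rw [Submodule.map_span, ← range_comp] at h
  exact (Submodule.dense_iff_topologicalClosure_eq_top).2 h

theorem inner_fourierL2 (m n : ℤ) :
    inner ℂ (fourierL2 μ m) (fourierL2 μ n) = ∫ z, fourier (n - m) z ∂μ := by
  rw [fourierL2, fourierL2, ContinuousMap.inner_toLp]
  simp_rw [← fourier_neg, ← fourier_add, sub_eq_add_neg]

variable {μ}

theorem ext_inner_fourierL2 {f g : Lp ℂ 2 μ}
    (h : ∀ n, inner ℂ f (fourierL2 μ n) = inner ℂ g (fourierL2 μ n)) : f = g := by
  have : innerSL ℂ f = innerSL ℂ g :=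
    ContinuousLinearMap.ext_on (dense_span_fourierL2 μ) (by rintro _ ⟨n, rfl⟩; exact h n)
  exact ext_inner_right ℂ fun v => congrArg (fun T => T v) this

/-- The norm of a combination depends only on the Gram matrix. This bound also makes the map between
spans well defined when the monomials are dependent in `L²(μ)`. -/
theorem norm_linearCombination_congr {ι E F : Type*} [NormedAddCommGroup E] [InnerProductSpace ℂ E]
    [NormedAddCommGroup F] [InnerProductSpace ℂ F] {x : ι → E} {y : ι → F}
    (h : ∀ i j, inner ℂ (x i) (x j) = inner ℂ (y i) (y j)) (c : ι →₀ ℂ) :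
    ‖Finsupp.linearCombination ℂ x c‖ = ‖Finsupp.linearCombination ℂ y c‖ := by
  have : (‖Finsupp.linearCombination ℂ x c‖ ^ 2 : ℂ) = ‖Finsupp.linearCombination ℂ y c‖ ^ 2 := by
    have h1 := inner_self_eq_norm_sq_to_K (𝕜 := ℂ) (Finsupp.linearCombination ℂ x c)
    have h2 := inner_self_eq_norm_sq_to_K (𝕜 := ℂ) (Finsupp.linearCombination ℂ y c)
    refine h1.symm.trans (Eq.trans ?_ h2)
    simp only [Finsupp.linearCombination_apply, Finsupp.sum, sum_inner, inner_sum, inner_smul_left,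
      inner_smul_right, h]
  have h' : ‖Finsupp.linearCombination ℂ x c‖ ^ 2 = ‖Finsupp.linearCombination ℂ y c‖ ^ 2 := by
    exact_mod_cast this
  exact (pow_left_inj₀ (norm_nonneg _) (norm_nonneg _) two_ne_zero).1 h'

/-- **Kolmogorov's isomorphism**: a stationary sequence is the image of the Fourier monomials
under an isometric embedding of `L²` of its spectral measure. -/
theorem exists_spectralIsometry {K : Type*} [NormedAddCommGroup K] [InnerProductSpace ℂ K]
    [CompleteSpace K] {y : ℤ → K}
    (hy : ∀ m n, inner ℂ (y m) (y n) = inner ℂ (y 0) (y (n - m)))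
    (hμ : ∀ n, ∫ z, fourier n z ∂μ = inner ℂ (y 0) (y n)) :
    ∃ T : Lp ℂ 2 μ →L[ℂ] K, (∀ n, T (fourierL2 μ n) = y n) ∧ ∀ f, ‖T f‖ ≤ ‖f‖ := by
  have hdense : DenseRange (Finsupp.linearCombination ℂ (fourierL2 μ)) := by
    have := dense_span_fourierL2 μ
    rw [← Finsupp.range_linearCombination] at this
    exact this
  have hnorm : ∀ c, ‖Finsupp.linearCombination ℂ y c‖
      ≤ 1 * ‖Finsupp.linearCombination ℂ (fourierL2 μ) c‖ := fun c => by
    rw [one_mul]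
    refine (norm_linearCombination_congr (fun m n => ?_) c).le
    rw [inner_fourierL2, hμ, hy]
  refine ⟨(Finsupp.linearCombination ℂ y).extendOfNorm
    (Finsupp.linearCombination ℂ (fourierL2 μ)), fun n => ?_, fun f => ?_⟩
  · have := LinearMap.extendOfNorm_eq hdense ⟨1, hnorm⟩ (Finsupp.single n 1)
    simpa using this
  · simpa using LinearMap.norm_extendOfNorm_apply_le hdense 1 hnorm f

/-- The class in `L²(μ)` of the indicator of `A`. -/
noncomputable def indicatorL2 (μ : Measure UnitAddCircle) [IsFiniteMeasure μ]
    {A : Set UnitAddCircle} (hA : MeasurableSet A) : Lp ℂ 2 μ :=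
  indicatorConstLp 2 hA (measure_ne_top μ A) 1

theorem inner_L2_eq {α : Type*} [MeasurableSpace α] {μ : Measure α} (f g : Lp ℂ 2 μ) : inner ℂ f g = ∫ z, g z * conj (f z) ∂μ := by
  rw [L2.inner_def]
  rfl

/-- The cross-covariance of two stationarily correlated spectral maps has a density. -/
theorem exists_crossDensity {H : Type*} [NormedAddCommGroup H] [InnerProductSpace ℂ H]
    [CompleteSpace H] (S T : Lp ℂ 2 μ →L[ℂ] H)
    (hST : ∀ m n, inner ℂ (S (fourierL2 μ m)) (T (fourierL2 μ n))
      = inner ℂ (S (fourierL2 μ 0)) (T (fourierL2 μ (n - m)))) :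
    ∃ φ : UnitAddCircle → ℂ, Integrable φ μ ∧
      ∀ (A B : Set UnitAddCircle) (hA : MeasurableSet A) (hB : MeasurableSet B),
        inner ℂ (S (indicatorL2 μ hA)) (T (indicatorL2 μ hB)) = ∫ z in A ∩ B, φ z ∂μ := by
  set w := T.adjoint (S (fourierL2 μ 0)) with hw
  have hwm : MemLp w 2 μ := Lp.memLp w
  have hcw : MemLp (fun z => conj (w z)) 2 μ := hwm.star
  refine ⟨fun z => conj (w z), hcw.integrable (by norm_num), fun A B hA hB => ?_⟩
  have hmul : ∀ m : ℤ, MemLp (fun z => fourier m z * w z) 2 μ := fun m => by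
    refine hwm.of_le ((fourier m).continuous.aestronglyMeasurable.mul hwm.1) (ae_of_all _ fun z => ?_)
    rw [norm_mul, fourier_apply, Circle.norm_coe, one_mul]
  -- Stationarity says that `T* S` maps `e_m` to `e_m w`.
  have hshift : ∀ m, T.adjoint (S (fourierL2 μ m)) = (hmul m).toLp := by
    intro m
    refine ext_inner_fourierL2 fun n => ?_
    rw [ContinuousLinearMap.adjoint_inner_left, hST, ← ContinuousLinearMap.adjoint_inner_left, ← hw,
      inner_L2_eq, inner_L2_eq]
    refine integral_congr_ae ?_
    filter_upwards [coeFn_fourierL2 μ n, coeFn_fourierL2 μ (n - m), (hmul m).coeFn_toLp]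
      with z h1 h2 h3
    rw [h1, h2, h3, map_mul, ← fourier_neg, sub_eq_add_neg, fourier_add]
    ring
  have hBm : MemLp (B.indicator fun z => conj (w z)) 2 μ := hcw.indicator hB
  -- Testing `S* T 1_B` against the `e_m` needs only the previous identity and identifies it as
  -- `1_B` times the conjugate of `w`, although `w` need not be bounded.
  have hB' : S.adjoint (T (indicatorL2 μ hB)) = hBm.toLp := by
    refine ext_inner_fourierL2 fun m => ?_
    rw [ContinuousLinearMap.adjoint_inner_left, ← inner_conj_symm,
      ← ContinuousLinearMap.adjoint_inner_left, hshift, ← inner_conj_symm, Complex.conj_conj,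
      indicatorL2, L2.inner_indicatorConstLp_one, inner_L2_eq, ← integral_indicator hB]
    refine integral_congr_ae ?_
    filter_upwards [coeFn_fourierL2 μ m, (hmul m).coeFn_toLp, hBm.coeFn_toLp] with z h1 h2 h3
    rw [h1, h3]
    by_cases hz : z ∈ B <;> simp [hz, h2, -fourier_apply]
  rw [← ContinuousLinearMap.adjoint_inner_right, hB', indicatorL2, L2.inner_indicatorConstLp_one,
    setIntegral_congr_ae hA (hBm.coeFn_toLp.mono fun z hz _ => hz), setIntegral_indicator hB]

/-- Presents integration as a bounded functional on `C(UnitAddCircle, ℂ)`, so that uniform sums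
integrate termwise and identities may be tested on monomials. The `star` undoes conjugate linearity
in the first slot. -/
theorem integral_eq_inner_toLp (μ : Measure UnitAddCircle) [IsFiniteMeasure μ]
    (f g : C(UnitAddCircle, ℂ)) :
    ∫ z, g z * f z ∂μ = inner ℂ (ContinuousMap.toLp (E := ℂ) 2 μ ℂ (star g))
      (ContinuousMap.toLp (E := ℂ) 2 μ ℂ f) := by
  rw [ContinuousMap.inner_toLp]
  simp [mul_comm]

/-- A finite measure on the circle with summable Fourier coefficients has a density. -/
theorem absolutelyContinuous_of_summable_fourier (μ : Measure UnitAddCircle) [IsFiniteMeasure μ]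
    (hs : Summable fun n : ℤ => ‖∫ z, fourier n z ∂μ‖) : μ ≪ haarAddCircle := by
  set r : ℤ → ℂ := fun n => ∫ z, fourier n z ∂μ with hr
  -- The candidate density is the uniformly convergent Fourier series of `μ`.
  have hsum : Summable fun n => r n • (fourier (-n) : C(UnitAddCircle, ℂ)) := by
    refine Summable.of_norm (hs.congr fun n => ?_)
    rw [norm_smul, fourier_norm, mul_one]
  obtain ⟨γ, hγ⟩ := hsum
  have hγr : ∀ n, ∫ z, γ z * fourier n z ∂haarAddCircle = r n := by
    intro n
    have h1 := hγ.mapL ((innerSL ℂ (ContinuousMap.toLp (E := ℂ) 2 haarAddCircle ℂ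
      (star (fourier n)))).comp (ContinuousMap.toLp (E := ℂ) 2 haarAddCircle ℂ))
    simp only [ContinuousLinearMap.comp_apply, innerSL_apply_apply, ← integral_eq_inner_toLp,
      ContinuousMap.smul_apply, smul_eq_mul] at h1
    have h2 : ∀ k, ∫ z, fourier n z * (r k * (fourier (-k) : C(UnitAddCircle, ℂ)) z) ∂haarAddCircle
        = if k = n then r n else 0 := by
      intro k
      have : ∀ z : UnitAddCircle, fourier n z * (r k * fourier (-k) z) = r k * fourier (n - k) z := by
        intro z
        rw [sub_eq_add_neg, fourier_add]; ring
      simp_rw [this]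
      rw [integral_const_mul, integral_fourier_haarAddCircle]
      by_cases h : k = n
      · simp [h]
      · rw [if_neg (by omega), if_neg h, mul_zero]
    simp_rw [h2] at h1
    rw [← h1.unique (hasSum_ite_eq n (r n))]
    simp_rw [mul_comm]
  have hext : ((innerSL ℂ (ContinuousMap.toLp (E := ℂ) 2 μ ℂ (star 1))).comp
      (ContinuousMap.toLp (E := ℂ) 2 μ ℂ))
      = ((innerSL ℂ (ContinuousMap.toLp (E := ℂ) 2 haarAddCircle ℂ (star γ))).comp
        (ContinuousMap.toLp (E := ℂ) 2 haarAddCircle ℂ)) := by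
    refine ContinuousLinearMap.ext_on dense_span_fourier ?_
    rintro _ ⟨n, rfl⟩
    simp only [ContinuousLinearMap.comp_apply, innerSL_apply_apply, ← integral_eq_inner_toLp, hγr,
      ContinuousMap.one_apply, one_mul, hr]
  have hint : ∀ f : C(UnitAddCircle, ℂ), ∫ z, f z ∂μ = ∫ z, γ z * f z ∂haarAddCircle := by
    intro f
    have := congrArg (fun L => L f) hext
    simpa only [ContinuousLinearMap.comp_apply, innerSL_apply_apply, ← integral_eq_inner_toLp,
      ContinuousMap.one_apply, one_mul] using this
  set a : UnitAddCircle → ℝ := fun z => (γ z).re with ha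
  have hac : Continuous a := Complex.continuous_re.comp γ.continuous
  have hreal : ∀ f : C(UnitAddCircle, ℝ), ∫ z, f z ∂μ = ∫ z, a z * f z ∂haarAddCircle := by
    intro f
    have h1 := hint ⟨fun z => (f z : ℂ), Complex.continuous_ofReal.comp f.continuous⟩
    simp only [ContinuousMap.coe_mk] at h1
    rw [integral_complex_ofReal] at h1
    have hI : Integrable (fun z => γ z * (f z : ℂ)) haarAddCircle :=
      ContinuousMap.integrable_of_finite ⟨fun z => γ z * (f z : ℂ),
        γ.continuous.mul (Complex.continuous_ofReal.comp f.continuous)⟩ haarAddCircle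
    have h2 := congrArg Complex.re h1
    rw [Complex.ofReal_re, ← RCLike.re_eq_complex_re, ← integral_re hI] at h2
    simpa [ha] using h2
  have hfin : ∀ b : UnitAddCircle → ℝ, Continuous b →
      IsFiniteMeasure ((haarAddCircle (T := 1)).withDensity fun z => ENNReal.ofReal (b z)) := by
    intro b hb
    refine isFiniteMeasure_withDensity_ofReal ?_
    exact (ContinuousMap.integrable_of_finite ⟨b, hb⟩ haarAddCircle).2
  have hf1 := hfin a hac
  have hf2 := hfin (fun z => -a z) hac.neg
  have hacn : Continuous fun z => -a z := hac.neg
  have hpart : ∀ (b : UnitAddCircle → ℝ), Continuous b → ∀ f : C(UnitAddCircle, ℝ),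
      ∫ z, f z ∂((haarAddCircle (T := 1)).withDensity fun z => ENNReal.ofReal (b z))
        = ∫ z, max (b z) 0 * f z ∂haarAddCircle := by
    intro b hb f
    rw [integral_withDensity_eq_integral_toReal_smul hb.measurable.ennreal_ofReal (by simp)]
    simp [ENNReal.toReal_ofReal']
  -- Nonnegativity of the real part `a` is never needed: adding the negative part of `a` to `μ`
  -- yields its positive part, so `μ` is dominated by the latter.
  have heq : μ + (haarAddCircle (T := 1)).withDensity (fun z => ENNReal.ofReal (-a z))
      = (haarAddCircle (T := 1)).withDensity fun z => ENNReal.ofReal (a z) := by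
    refine ext_of_forall_integral_eq_of_IsFiniteMeasure fun f => ?_
    have hi : ∀ b : UnitAddCircle → ℝ, Continuous b →
        Integrable (fun z => b z * f z) (haarAddCircle (T := 1)) := fun b hb =>
      ContinuousMap.integrable_of_finite ⟨fun z => b z * f z, hb.mul f.continuous⟩ haarAddCircle
    have hfi : ∀ (ν : Measure UnitAddCircle) [IsFiniteMeasure ν], Integrable f ν := fun ν _ =>
      ContinuousMap.integrable_of_finite f.toContinuousMap ν
    rw [integral_add_measure (hfi _) (hfi _)]
    have e1 := hreal f.toContinuousMap
    have e2 := hpart _ hac f.toContinuousMap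
    have e3 := hpart (fun z => -a z) hacn f.toContinuousMap
    simp only [BoundedContinuousFunction.coe_toContinuousMap] at e1 e2 e3
    rw [e1, e2, e3, ← integral_add (hi _ hac) (hi _ (hacn.max continuous_const))]
    refine integral_congr_ae (ae_of_all _ fun z => ?_)
    change a z * f z + max (-a z) 0 * f z = max (a z) 0 * f z
    rw [← add_mul]
    congr 1
    rcases le_total (a z) 0 with h | h
    · rw [max_eq_right h, max_eq_left (by linarith)]; ring
    · rw [max_eq_left h, max_eq_right (by linarith)]; ring
  have hle : μ ≤ (haarAddCircle (T := 1)).withDensity fun z => ENNReal.ofReal (a z) :=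
    heq ▸ Measure.le_add_right le_rfl
  exact hle.absolutelyContinuous.trans (withDensity_absolutelyContinuous _ _)

end SpectralIsometry

/-! ### Frequencies in `(-1/2, 1/2]` and step-function approximation. -/

section Frequency

open AddCircle ComplexConjugate

/-- The representative in `(-1/2, 1/2]` of a point of the circle. -/
noncomputable def freq (z : UnitAddCircle) : ℝ := equivIoc 1 (-(1 / 2)) z

theorem freq_mem (z : UnitAddCircle) : freq z ∈ Ioc (-(1 / 2) : ℝ) (1 / 2) := by
  have h := (equivIoc (1 : ℝ) (-(1 / 2)) z).2
  norm_num at h ⊢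
  exact h

theorem coe_freq (z : UnitAddCircle) : (freq z : UnitAddCircle) = z :=
  (equivIoc (1 : ℝ) (-(1 / 2))).symm_apply_apply z

theorem measurableEmbedding_freq : MeasurableEmbedding freq :=
  (MeasurableEmbedding.subtype_coe measurableSet_Ioc).comp
    (measurableEquivIoc 1 (-(1 / 2))).measurableEmbedding

theorem map_freq_absolutelyContinuous {μ : Measure UnitAddCircle} (h : μ ≪ haarAddCircle) :
    μ.map freq ≪ volume := by
  have hv : (volume : Measure UnitAddCircle) = haarAddCircle := by
    rw [volume_eq_smul_haarAddCircle, ENNReal.ofReal_one, one_smul]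
  rw [← hv] at h
  refine (h.map measurableEmbedding_freq.measurable).trans ?_
  have h1 : (volume : Measure UnitAddCircle).map freq
      = volume.restrict (Ioc (-(1 / 2) : ℝ) (-(1 / 2) + 1)) := by
    rw [← map_comap_subtype_coe measurableSet_Ioc,
      ← (measurePreserving_equivIoc (1 : ℝ) (a := -(1 / 2))).map_eq,
      Measure.map_map measurable_subtype_coe (measurePreserving_equivIoc (1 : ℝ)).measurable]
    rfl
  rw [h1]
  exact Measure.restrict_le_self.absolutelyContinuous

theorem fourier_eq_exp_freq (n : ℤ) (z : UnitAddCircle) :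
    fourier n z = Complex.exp (Complex.I * (2 * Real.pi * freq z * n : ℝ)) := by
  conv_lhs => rw [← coe_freq z, fourier_coe_apply]
  congr 1
  push_cast
  ring

theorem norm_exp_I_mul_sub_exp_le (x y : ℝ) :
    ‖Complex.exp (Complex.I * x) - Complex.exp (Complex.I * y)‖ ≤ |x - y| := by
  have h : Complex.exp (Complex.I * x) - Complex.exp (Complex.I * y)
      = Complex.exp (y * Complex.I) * (Complex.exp (Complex.I * (x - y : ℝ)) - 1) := by
    rw [mul_sub, ← Complex.exp_add, mul_one, mul_comm (y : ℂ)]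
    congr 2
    push_cast; ring
  rw [h, norm_mul, Complex.norm_exp_ofReal_mul_I, one_mul]
  exact Real.norm_exp_I_mul_ofReal_sub_one_le

theorem sum_indicator_Ioc_eq_zero {n : ℕ} {p : ℕ → ℝ} (hp : ∀ k < n, p k ≤ p (k + 1)) {s : ℝ}
    (hs : p n < s) (c : ℕ → ℂ) :
    ∑ k ∈ Finset.range n, (Ioc (p k) (p (k + 1))).indicator (fun _ => c k) s = 0 := by
  induction n with
  | zero => simp
  | succ n ih =>
    rw [Finset.sum_range_succ,
      ih (fun k hk => hp k (hk.trans n.lt_succ_self)) ((hp n n.lt_succ_self).trans_lt hs), zero_add]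
    exact indicator_of_notMem (fun h => h.2.not_gt hs) _

/-- Repeated partition points are harmless, since a degenerate `Ioc` is empty. -/
theorem exists_sum_indicator_Ioc_eq {n : ℕ} {p : ℕ → ℝ} (hp : ∀ k < n, p k ≤ p (k + 1)) {s : ℝ}
    (hs : s ∈ Ioc (p 0) (p n)) (c : ℕ → ℂ) :
    ∃ k < n, s ∈ Ioc (p k) (p (k + 1)) ∧
      ∑ k ∈ Finset.range n, (Ioc (p k) (p (k + 1))).indicator (fun _ => c k) s = c k := by
  induction n with
  | zero => exact absurd hs (by simp)
  | succ n ih =>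
    have hp' : ∀ k < n, p k ≤ p (k + 1) := fun k hk => hp k (hk.trans n.lt_succ_self)
    rcases le_or_gt s (p n) with h | h
    · obtain ⟨k, hk, hsk, hsum⟩ := ih hp' ⟨hs.1, h⟩
      refine ⟨k, hk.trans n.lt_succ_self, hsk, ?_⟩
      rw [Finset.sum_range_succ, hsum, indicator_of_notMem (fun h' => h'.1.not_ge h), add_zero]
    · refine ⟨n, n.lt_succ_self, ⟨h, hs.2⟩, ?_⟩
      rw [Finset.sum_range_succ, sum_indicator_Ioc_eq_zero hp' h, zero_add,
        indicator_of_mem (show s ∈ Ioc (p n) (p (n + 1)) from ⟨h, hs.2⟩)]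

variable (μ : Measure UnitAddCircle) [IsFiniteMeasure μ]

/-- The class in `L²(μ)` of the indicator of the frequency band `(a, b]`. -/
noncomputable def bandL2 (a b : ℝ) : Lp ℂ 2 μ :=
  indicatorL2 μ (measurableEmbedding_freq.measurable (measurableSet_Ioc (a := a) (b := b)))

theorem coeFn_bandL2 (a b : ℝ) :
    bandL2 μ a b =ᵐ[μ] fun z => (Ioc a b).indicator (fun _ => 1) (freq z) :=
  indicatorConstLp_coeFn (hs := measurableEmbedding_freq.measurable measurableSet_Ioc)
    (hμs := measure_ne_top μ _) (c := (1 : ℂ))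

theorem bandL2_sub {a b c : ℝ} (hab : a ≤ b) (hbc : b ≤ c) :
    bandL2 μ a c - bandL2 μ a b = bandL2 μ b c := by
  rw [sub_eq_iff_eq_add]
  refine Lp.ext ?_
  filter_upwards [coeFn_bandL2 μ a c, coeFn_bandL2 μ a b, coeFn_bandL2 μ b c,
    Lp.coeFn_add (bandL2 μ b c) (bandL2 μ a b)] with z h1 h2 h3 h4
  rw [h4, Pi.add_apply, h1, h2, h3, ← Ioc_union_Ioc_eq_Ioc hab hbc, add_comm]
  exact congrFun (indicator_union_of_disjoint
    (Ioc_disjoint_Ioc_of_le le_rfl) (fun _ : ℝ => (1 : ℂ))) _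

/-- The bands cover every value of `freq`. Within one band the frequency and the tag differ by at
most `δ`, and the exponential is `2π|t|`-Lipschitz; the first factor is the square root of the mass
of `μ`. -/
theorem norm_fourierL2_sub_sum_bandL2_le {n : ℕ} {p ξ : ℕ → ℝ} {δ : ℝ} (hδ : 0 ≤ δ)
    (h0 : p 0 = -(1 / 2)) (h1 : p n = 1 / 2)
    (hp : ∀ k < n, p k ≤ ξ k ∧ ξ k ≤ p (k + 1) ∧ p (k + 1) - p k < δ) (t : ℤ) :
    ‖fourierL2 μ t - ∑ k ∈ Finset.range n,
        Complex.exp (Complex.I * (2 * Real.pi * ξ k * t : ℝ)) • bandL2 μ (p k) (p (k + 1))‖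
      ≤ (measureUnivNNReal μ : ℝ) ^ (2 : ℝ≥0∞).toReal⁻¹ * (2 * Real.pi * |(t : ℝ)| * δ) := by
  refine Lp.norm_le_of_ae_bound (by positivity) ?_
  have hsm : ∀ᵐ z ∂μ, ∀ k, (Complex.exp (Complex.I * (2 * Real.pi * ξ k * t : ℝ)) •
      bandL2 μ (p k) (p (k + 1)) : Lp ℂ 2 μ) z = (Ioc (p k) (p (k + 1))).indicator
        (fun _ => Complex.exp (Complex.I * (2 * Real.pi * ξ k * t : ℝ))) (freq z) := by
    refine ae_all_iff.2 fun k => ?_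
    filter_upwards [coeFn_bandL2 μ (p k) (p (k + 1)), Lp.coeFn_smul
      (Complex.exp (Complex.I * (2 * Real.pi * ξ k * t : ℝ))) (bandL2 μ (p k) (p (k + 1)))]
      with z e1 e2
    rw [e2, Pi.smul_apply, e1]
    by_cases hz : freq z ∈ Ioc (p k) (p (k + 1))
    · rw [indicator_of_mem hz, indicator_of_mem hz, smul_eq_mul, mul_one]
    · rw [indicator_of_notMem hz, indicator_of_notMem hz, smul_zero]
  filter_upwards [coeFn_fourierL2 μ t, hsm, Lp.coeFn_sub (fourierL2 μ t)
    (∑ k ∈ Finset.range n,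
      Complex.exp (Complex.I * (2 * Real.pi * ξ k * t : ℝ)) • bandL2 μ (p k) (p (k + 1))),
    Lp.coeFn_fun_finsetSum (Finset.range n) (fun k =>
      Complex.exp (Complex.I * (2 * Real.pi * ξ k * t : ℝ)) • bandL2 μ (p k) (p (k + 1)))]
    with z e1 e2 e3 e4
  rw [e3, Pi.sub_apply, e4, e1]
  simp_rw [e2]
  obtain ⟨k, hk, hs, hsum⟩ := exists_sum_indicator_Ioc_eq (n := n) (p := p) (s := freq z)
    (fun k hk => (hp k hk).1.trans (hp k hk).2.1) (by rw [h0, h1]; exact freq_mem z)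
    (fun k => Complex.exp (Complex.I * (2 * Real.pi * ξ k * t : ℝ)))
  rw [hsum, fourier_eq_exp_freq]
  refine (norm_exp_I_mul_sub_exp_le _ _).trans ?_
  have : 2 * Real.pi * freq z * t - 2 * Real.pi * ξ k * t
      = 2 * Real.pi * t * (freq z - ξ k) := by ring
  rw [this, abs_mul, abs_mul, abs_of_pos Real.two_pi_pos]
  refine mul_le_mul_of_nonneg_left ?_ (by positivity)
  obtain ⟨q1, q2, q3⟩ := hp k hk
  rw [abs_le]
  constructor <;> linarith [hs.1, hs.2]

end Frequency

/-! ### Quaternions as pairs of complex numbers. -/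

section QuaternionPairs

open ComplexConjugate

/-- The quaternion `z + i w`, for `z` and `w` in the complex plane spanned by `1` and `j`. -/
noncomputable def quatPair : ℂ × ℂ →L[ℝ] ℍ[ℝ] :=
  LinearMap.toContinuousLinearMap
    { toFun := fun p => (⟨p.1.re, p.2.re, p.1.im, p.2.im⟩ : ℍ[ℝ])
      map_add' := fun p q => by ext <;> rfl
      map_smul' := fun r p => by ext <;> simp <;> rfl }

@[simp] theorem re_quatPair (z w : ℂ) : (quatPair (z, w)).re = z.re := rfl
@[simp] theorem imI_quatPair (z w : ℂ) : (quatPair (z, w)).imI = w.re := rfl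
@[simp] theorem imJ_quatPair (z w : ℂ) : (quatPair (z, w)).imJ = z.im := rfl
@[simp] theorem imK_quatPair (z w : ℂ) : (quatPair (z, w)).imK = w.im := rfl

@[simp] theorem re_expJ (θ : ℝ) : (expJ θ).re = Real.cos θ := rfl
@[simp] theorem imI_expJ (θ : ℝ) : (expJ θ).imI = 0 := rfl
@[simp] theorem imJ_expJ (θ : ℝ) : (expJ θ).imJ = Real.sin θ := rfl
@[simp] theorem imK_expJ (θ : ℝ) : (expJ θ).imK = 0 := rfl

/-- The plane of `1` and `j` is commutative and stands to the right of `i` in `z + i w`. -/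
theorem quatPair_mul_expJ (z w : ℂ) (θ : ℝ) :
    quatPair (z, w) * expJ θ
      = quatPair (Complex.exp (Complex.I * θ) * z, Complex.exp (Complex.I * θ) * w) := by
  rw [mul_comm Complex.I, Complex.exp_mul_I, ← Complex.ofReal_cos, ← Complex.ofReal_sin]
  ext <;> simp [-Complex.ofReal_cos, -Complex.ofReal_sin] <;> ring

theorem quatPair_mul_star (z w z' w' : ℂ) :
    quatPair (z, w) * star (quatPair (z', w'))
      = quatPair (z * conj z' + w' * conj w, w * conj z' - w' * conj z) := by
  ext <;> simp <;> ring

/-- `starJ` sends `z' + i w'` to `conj z' + i w'`, whereas `star` gives `conj z' - i w'`; moving `i`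
past a factor of the plane conjugates that factor. -/
theorem quatPair_mul_starJ (z w z' w' : ℂ) :
    quatPair (z, w) * starJ (quatPair (z', w'))
      = quatPair (z * conj z' - w' * conj w, w * conj z' + w' * conj z) := by
  ext <;> simp [starJ] <;> ring

theorem quatPair_mul_quatJ (z w : ℂ) :
    quatPair (z, w) * quatJ = quatPair (z * Complex.I, w * Complex.I) := by
  ext <;> simp

theorem coe_eq_quatPair (r : ℝ) : (r : ℍ[ℝ]) = quatPair (r, 0) := by
  ext <;> simp

theorem norm_sq_quatPair (z w : ℂ) : ‖quatPair (z, w)‖ ^ 2 = ‖z‖ ^ 2 + ‖w‖ ^ 2 := by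
  rw [sq, ← Quaternion.normSq_eq_norm_mul_self, Quaternion.normSq_def', Complex.sq_norm,
    Complex.sq_norm, Complex.normSq_apply, Complex.normSq_apply]
  simp only [re_quatPair, imI_quatPair, imJ_quatPair, imK_quatPair]
  ring

theorem norm_quatPair_le (z w : ℂ) : ‖quatPair (z, w)‖ ≤ ‖z‖ + ‖w‖ := by
  refine le_of_sq_le_sq ?_ (by positivity)
  rw [norm_sq_quatPair]
  nlinarith [norm_nonneg z, norm_nonneg w]

variable {Ω : Type*} [MeasurableSpace Ω] {P : Measure Ω}

theorem integral_quatPair {f g : Ω → ℂ} (hf : Integrable f P) (hg : Integrable g P) :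
    ∫ ω, quatPair (f ω, g ω) ∂P = quatPair (∫ ω, f ω ∂P, ∫ ω, g ω ∂P) := by
  rw [quatPair.integral_comp_comm (hf.prodMk hg), integral_pair hf hg]

theorem memLp_quatPair {f g : Ω → ℂ} {q : ℝ≥0∞} (hf : MemLp f q P) (hg : MemLp g q P) :
    MemLp (fun ω => quatPair (f ω, g ω)) q P :=
  (hf.norm.add hg.norm).of_le (quatPair.continuous.comp_aestronglyMeasurable (hf.1.prodMk hg.1))
    (ae_of_all _ fun _ => (norm_quatPair_le _ _).trans (le_abs_self _))

theorem eLpNorm_quatPair_le (f g : Lp ℂ 2 P) :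
    eLpNorm (fun ω => quatPair (f ω, g ω)) 2 P ≤ ENNReal.ofReal (‖f‖ + ‖g‖) := by
  have h1 : eLpNorm (fun ω => quatPair (f ω, g ω)) 2 P
      ≤ eLpNorm (fun ω => ‖f ω‖ + ‖g ω‖) 2 P :=
    eLpNorm_mono_real fun _ => norm_quatPair_le _ _
  refine h1.trans ((eLpNorm_add_le (Lp.aestronglyMeasurable f).norm
    (Lp.aestronglyMeasurable g).norm one_le_two).trans ?_)
  rw [eLpNorm_norm, eLpNorm_norm, ENNReal.ofReal_add (norm_nonneg _) (norm_nonneg _),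
    Lp.norm_def, Lp.norm_def, ENNReal.ofReal_toReal (Lp.eLpNorm_ne_top _),
    ENNReal.ofReal_toReal (Lp.eLpNorm_ne_top _)]

theorem integrable_mul_conj (f g : Lp ℂ 2 P) : Integrable (fun ω => g ω * conj (f ω)) P :=
  L2.integrable_inner (𝕜 := ℂ) f g

theorem integrable_mul_conj_sub (f g f' g' : Lp ℂ 2 P) :
    Integrable (fun ω => g ω * conj (f ω) - g' ω * conj (f' ω)) P :=
  (integrable_mul_conj f g).sub (integrable_mul_conj f' g')

theorem integral_quatPair_mul_star (f g f' g' : Lp ℂ 2 P) :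
    ∫ ω, quatPair (f ω, g ω) * star (quatPair (f' ω, g' ω)) ∂P
      = quatPair (inner ℂ f' f + inner ℂ g g', inner ℂ f' g - inner ℂ f g') := by
  simp_rw [quatPair_mul_star]
  rw [integral_quatPair ((integrable_mul_conj f' f).fun_add (integrable_mul_conj g g'))
    (integrable_mul_conj_sub f' g f g'),
    integral_add (integrable_mul_conj _ _) (integrable_mul_conj _ _),
    integral_sub (integrable_mul_conj _ _) (integrable_mul_conj _ _)]
  simp_rw [inner_L2_eq]

theorem integral_quatPair_mul_starJ (f g f' g' : Lp ℂ 2 P) :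
    ∫ ω, quatPair (f ω, g ω) * starJ (quatPair (f' ω, g' ω)) ∂P
      = quatPair (inner ℂ f' f - inner ℂ g g', inner ℂ f' g + inner ℂ f g') := by
  simp_rw [quatPair_mul_starJ]
  rw [integral_quatPair (integrable_mul_conj_sub f' f g g')
    ((integrable_mul_conj f' g).fun_add (integrable_mul_conj f g')),
    integral_add (integrable_mul_conj _ _) (integrable_mul_conj _ _),
    integral_sub (integrable_mul_conj _ _) (integrable_mul_conj _ _)]
  simp_rw [inner_L2_eq]

theorem integral_norm_sq_quatPair (f g : Lp ℂ 2 P) :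
    ((∫ ω, ‖quatPair (f ω, g ω)‖ ^ 2 ∂P : ℝ) : ℂ) = inner ℂ f f + inner ℂ g g := by
  have h : ∀ f : Lp ℂ 2 P, ∀ ω, f ω * conj (f ω) = ((‖f ω‖ ^ 2 : ℝ) : ℂ) := fun f ω => by
    rw [Complex.mul_conj, Complex.normSq_eq_norm_sq]
  rw [inner_L2_eq, inner_L2_eq, ← integral_add (integrable_mul_conj _ _) (integrable_mul_conj _ _),
    ← integral_complex_ofReal]
  refine integral_congr_ae (ae_of_all _ fun ω => ?_)
  simp only [h, norm_sq_quatPair]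
  push_cast
  rfl

end QuaternionPairs

/-! ### The process `X`: moments of increments and the mean-square integral. -/

section CumulativeSpectrum

open AddCircle ComplexConjugate

/-- Herglotz and Kolmogorov are applied to the pair in the Hilbert sum, so that `S` and `T` share
one `L²(μ)`; coordinate projections do not increase norms. -/
theorem exists_jointSpectralMaps {H : Type*} [NormedAddCommGroup H] [InnerProductSpace ℂ H]
    [CompleteSpace H] {x y : ℤ → H}
    (hx : ∀ m n, inner ℂ (x m) (x n) = inner ℂ (x 0) (x (n - m)))
    (hy : ∀ m n, inner ℂ (y m) (y n) = inner ℂ (y 0) (y (n - m))) :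
    ∃ (μ : Measure UnitAddCircle) (_ : IsFiniteMeasure μ) (S T : Lp ℂ 2 μ →L[ℂ] H),
      (∀ n, ∫ z, fourier n z ∂μ = inner ℂ (x 0) (x n) + inner ℂ (y 0) (y n)) ∧
      (∀ n, S (fourierL2 μ n) = x n) ∧ (∀ n, T (fourierL2 μ n) = y n) ∧
      (∀ f, ‖S f‖ ≤ ‖f‖) ∧ (∀ f, ‖T f‖ ≤ ‖f‖) := by
  set w : ℤ → WithLp 2 (H × H) := fun n => WithLp.toLp 2 (x n, y n) with hw
  have hinner : ∀ m n, inner ℂ (w m) (w n) = inner ℂ (x m) (x n) + inner ℂ (y m) (y n) :=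
    fun m n => WithLp.prod_inner_apply _ _
  have hws : ∀ m n, inner ℂ (w m) (w n) = inner ℂ (w 0) (w (n - m)) := fun m n => by
    rw [hinner, hinner, hx, hy]
  obtain ⟨μ, hfin, hμ⟩ := exists_spectralMeasure hws
  obtain ⟨T, hT, hTn⟩ := exists_spectralIsometry hws hμ
  refine ⟨μ, hfin, (WithLp.fstL 2 ℂ H H).comp T, (WithLp.sndL 2 ℂ H H).comp T,
    fun n => by rw [hμ, hinner], fun n => ?_, fun n => ?_, fun f => ?_, fun f => ?_⟩
  · simp [hT, hw]
  · simp [hT, hw]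
  · refine le_trans ?_ (hTn f)
    refine le_of_sq_le_sq ?_ (norm_nonneg _)
    rw [WithLp.prod_norm_sq_eq_of_L2]
    exact le_add_of_nonneg_right (sq_nonneg _)
  · refine le_trans ?_ (hTn f)
    refine le_of_sq_le_sq ?_ (norm_nonneg _)
    rw [WithLp.prod_norm_sq_eq_of_L2]
    exact le_add_of_nonneg_left (sq_nonneg _)

variable {Ω : Type*} [MeasurableSpace Ω] {P : Measure Ω}

/-- A real square-integrable random variable as an element of the complex `L²` space. -/
noncomputable def complexL2 {f : Ω → ℝ} (hf : MemLp f 2 P) : Lp ℂ 2 P :=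
  (hf.ofReal (K := ℂ)).toLp

theorem coeFn_complexL2 {f : Ω → ℝ} (hf : MemLp f 2 P) :
    complexL2 hf =ᵐ[P] fun ω => (f ω : ℂ) :=
  (hf.ofReal (K := ℂ)).coeFn_toLp

theorem inner_complexL2 {f g : Ω → ℝ} (hf : MemLp f 2 P) (hg : MemLp g 2 P) :
    inner ℂ (complexL2 hf) (complexL2 hg) = ((∫ ω, f ω * g ω ∂P : ℝ) : ℂ) := by
  rw [inner_L2_eq, ← integral_complex_ofReal]
  refine integral_congr_ae ?_
  filter_upwards [coeFn_complexL2 hf, coeFn_complexL2 hg] with ω h1 h2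
  rw [h1, h2, Complex.conj_ofReal, mul_comm]
  push_cast
  rfl

variable {μ : Measure UnitAddCircle} [IsFiniteMeasure μ] (S T : Lp ℂ 2 μ →L[ℂ] Lp ℂ 2 P)

/-- The mean is the inner product with the constant `1`, a continuous functional, so it suffices to
check the dense span of the monomials. -/
theorem integral_apply_eq_zero [IsFiniteMeasure P]
    (h : ∀ n, ∫ ω, S (fourierL2 μ n) ω ∂P = 0) (f : Lp ℂ 2 μ) : ∫ ω, S f ω ∂P = 0 := by
  have hone : ∀ g : Lp ℂ 2 P, ∫ ω, g ω ∂P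
      = inner ℂ (indicatorConstLp 2 MeasurableSet.univ (measure_ne_top P univ) (1 : ℂ)) g :=
    fun g => by rw [L2.inner_indicatorConstLp_one, setIntegral_univ]
  have : (innerSL ℂ (indicatorConstLp 2 MeasurableSet.univ (measure_ne_top P univ) (1 : ℂ))).comp S
      = 0 := by
    refine ContinuousLinearMap.ext_on (dense_span_fourierL2 μ) ?_
    rintro _ ⟨n, rfl⟩
    simpa [hone] using h n
  rw [hone]
  exact congrArg (fun L => L f) this

/-- The quaternion process with increments `S 1_{(a, b]} + i T 1_{(a, b]}`. -/
noncomputable def cumulativeSpectrum (ν : ℝ) (ω : Ω) : ℍ[ℝ] :=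
  quatPair (S (bandL2 μ (-(1 / 2)) ν) ω, T (bandL2 μ (-(1 / 2)) ν) ω)

theorem memLp_cumulativeSpectrum (ν : ℝ) : MemLp (cumulativeSpectrum S T ν) 2 P :=
  memLp_quatPair (Lp.memLp _) (Lp.memLp _)

theorem cumulativeSpectrum_sub_ae {a b : ℝ} (ha : -(1 / 2) ≤ a) (hab : a ≤ b) :
    (fun ω => cumulativeSpectrum S T b ω - cumulativeSpectrum S T a ω)
      =ᵐ[P] fun ω => quatPair (S (bandL2 μ a b) ω, T (bandL2 μ a b) ω) := by
  have hS := Lp.coeFn_sub (S (bandL2 μ (-(1 / 2)) b)) (S (bandL2 μ (-(1 / 2)) a))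
  have hT := Lp.coeFn_sub (T (bandL2 μ (-(1 / 2)) b)) (T (bandL2 μ (-(1 / 2)) a))
  rw [← map_sub, bandL2_sub μ ha hab] at hS hT
  filter_upwards [hS, hT] with ω h1 h2
  rw [h1, h2, cumulativeSpectrum, cumulativeSpectrum, ← map_sub]
  rfl

theorem integral_cumulativeSpectrum_sub_mul_star {a b c d : ℝ} (ha : -(1 / 2) ≤ a) (hab : a ≤ b)
    (hc : -(1 / 2) ≤ c) (hcd : c ≤ d) :
    ∫ ω, (cumulativeSpectrum S T b ω - cumulativeSpectrum S T a ω)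
        * star (cumulativeSpectrum S T d ω - cumulativeSpectrum S T c ω) ∂P
      = quatPair (inner ℂ (S (bandL2 μ c d)) (S (bandL2 μ a b))
          + inner ℂ (T (bandL2 μ a b)) (T (bandL2 μ c d)),
        inner ℂ (S (bandL2 μ c d)) (T (bandL2 μ a b))
          - inner ℂ (S (bandL2 μ a b)) (T (bandL2 μ c d))) := by
  rw [← integral_quatPair_mul_star]
  refine integral_congr_ae ?_
  filter_upwards [cumulativeSpectrum_sub_ae S T ha hab, cumulativeSpectrum_sub_ae S T hc hcd]
    with ω h1 h2
  rw [h1, h2]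

theorem integral_cumulativeSpectrum_sub_mul_starJ {a b c d : ℝ} (ha : -(1 / 2) ≤ a) (hab : a ≤ b)
    (hc : -(1 / 2) ≤ c) (hcd : c ≤ d) :
    ∫ ω, (cumulativeSpectrum S T b ω - cumulativeSpectrum S T a ω)
        * starJ (cumulativeSpectrum S T d ω - cumulativeSpectrum S T c ω) ∂P
      = quatPair (inner ℂ (S (bandL2 μ c d)) (S (bandL2 μ a b))
          - inner ℂ (T (bandL2 μ a b)) (T (bandL2 μ c d)),
        inner ℂ (S (bandL2 μ c d)) (T (bandL2 μ a b))
          + inner ℂ (S (bandL2 μ a b)) (T (bandL2 μ c d))) := by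
  rw [← integral_quatPair_mul_starJ]
  refine integral_congr_ae ?_
  filter_upwards [cumulativeSpectrum_sub_ae S T ha hab, cumulativeSpectrum_sub_ae S T hc hcd]
    with ω h1 h2
  rw [h1, h2]

theorem integral_norm_sq_cumulativeSpectrum_sub {a b : ℝ} (ha : -(1 / 2) ≤ a) (hab : a ≤ b) :
    ((∫ ω, ‖cumulativeSpectrum S T b ω - cumulativeSpectrum S T a ω‖ ^ 2 ∂P : ℝ) : ℂ)
      = inner ℂ (S (bandL2 μ a b)) (S (bandL2 μ a b))
        + inner ℂ (T (bandL2 μ a b)) (T (bandL2 μ a b)) := by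
  rw [← integral_norm_sq_quatPair]
  congr 1
  refine integral_congr_ae ?_
  filter_upwards [cumulativeSpectrum_sub_ae S T ha hab] with ω h1
  rw [h1]

theorem integral_cumulativeSpectrum_sub_eq_zero [IsFiniteMeasure P]
    (hS : ∀ n, ∫ ω, S (fourierL2 μ n) ω ∂P = 0) (hT : ∀ n, ∫ ω, T (fourierL2 μ n) ω ∂P = 0)
    {a b : ℝ} (ha : -(1 / 2) ≤ a) (hab : a ≤ b) :
    ∫ ω, (cumulativeSpectrum S T b ω - cumulativeSpectrum S T a ω) ∂P = 0 := by
  rw [integral_congr_ae (cumulativeSpectrum_sub_ae S T ha hab),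
    integral_quatPair ((Lp.memLp _).integrable one_le_two) ((Lp.memLp _).integrable one_le_two),
    integral_apply_eq_zero S hS, integral_apply_eq_zero T hT]
  exact map_zero quatPair

theorem isMeanSquareStieltjesIntegral_cumulativeSpectrum {f g : Ω → ℝ} (hf : MemLp f 2 P)
    (hg : MemLp g 2 P) (t : ℤ) (hSt : S (fourierL2 μ t) = complexL2 hf)
    (hTt : T (fourierL2 μ t) = complexL2 hg) (hS : ∀ f, ‖S f‖ ≤ ‖f‖) (hT : ∀ f, ‖T f‖ ≤ ‖f‖) :
    IsMeanSquareStieltjesIntegral P (cumulativeSpectrum S T)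
      (fun ν => expJ (2 * Real.pi * ν * t)) (fun ω => quatI (f ω) (g ω)) := by
  intro ε hε
  set C : ℝ := (measureUnivNNReal μ : ℝ) ^ (2 : ℝ≥0∞).toReal⁻¹ * (2 * Real.pi * |(t : ℝ)|) with hC
  have hC0 : 0 ≤ C := by positivity
  -- Each of the two components contributes at most `C * δ`; the `+ 1` keeps the inequality strict
  -- and the denominator positive.
  refine ⟨ε / (2 * C + 1), by positivity, fun n p ξ h0 h1 hp => ?_⟩
  set δ := ε / (2 * C + 1) with hδ
  have hδ0 : 0 ≤ δ := by positivity
  set c : ℕ → ℂ := fun k => Complex.exp (Complex.I * (2 * Real.pi * ξ k * t : ℝ)) with hc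
  set r : Lp ℂ 2 μ := fourierL2 μ t
    - ∑ k ∈ Finset.range n, c k • bandL2 μ (p k) (p (k + 1)) with hr
  have hrn : ‖r‖ ≤ C * δ := by
    refine (norm_fourierL2_sub_sum_bandL2_le μ hδ0 h0 h1 hp t).trans_eq ?_
    rw [hC]; ring
  have hlow : ∀ k ≤ n, -(1 / 2) ≤ p k := by
    intro k
    induction k with
    | zero => exact fun _ => h0.ge
    | succ k ih => exact fun hk => (ih (by omega)).trans ((hp k hk).1.trans (hp k hk).2.1)
  have happ : ∀ (R : Lp ℂ 2 μ →L[ℂ] Lp ℂ 2 P) {q : Ω → ℝ} (hq : MemLp q 2 P),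
      R (fourierL2 μ t) = complexL2 hq → ∀ᵐ ω ∂P, R r ω
        = q ω - ∑ k ∈ Finset.range n, c k * R (bandL2 μ (p k) (p (k + 1))) ω := by
    intro R q hq hR
    rw [hr, map_sub, hR, map_sum]
    simp_rw [map_smul]
    have hsm : ∀ᵐ ω ∂P, ∀ k, (c k • R (bandL2 μ (p k) (p (k + 1))) : Lp ℂ 2 P) ω
        = c k * R (bandL2 μ (p k) (p (k + 1))) ω := ae_all_iff.2 fun k => Lp.coeFn_smul _ _
    filter_upwards [hsm, Lp.coeFn_sub (complexL2 hq)
      (∑ k ∈ Finset.range n, c k • R (bandL2 μ (p k) (p (k + 1)))), coeFn_complexL2 hq,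
      Lp.coeFn_fun_finsetSum (Finset.range n) fun k => c k • R (bandL2 μ (p k) (p (k + 1)))]
      with ω e1 e2 e3 e4
    rw [e2, Pi.sub_apply, e3, e4]
    simp_rw [e1]
  have hincr : ∀ᵐ ω ∂P, ∀ k, k < n → cumulativeSpectrum S T (p (k + 1)) ω - cumulativeSpectrum S T (p k) ω
      = quatPair (S (bandL2 μ (p k) (p (k + 1))) ω, T (bandL2 μ (p k) (p (k + 1))) ω) := by
    refine ae_all_iff.2 fun k => ?_
    by_cases hk : k < n
    · filter_upwards [cumulativeSpectrum_sub_ae S T (hlow k hk.le)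
        ((hp k hk).1.trans (hp k hk).2.1)] with ω h _ using h
    · exact ae_of_all _ fun _ h => absurd h hk
  have hae : (fun ω => quatI (f ω) (g ω) - ∑ k ∈ Finset.range n,
      (cumulativeSpectrum S T (p (k + 1)) ω - cumulativeSpectrum S T (p k) ω)
        * expJ (2 * Real.pi * ξ k * t)) =ᵐ[P] fun ω => quatPair (S r ω, T r ω) := by
    filter_upwards [happ S hf hSt, happ T hg hTt, hincr] with ω e1 e2 e3
    have hq : quatI (f ω) (g ω) = quatPair (f ω, g ω) := by ext <;> simp [quatI]
    have hsum : ∑ k ∈ Finset.range n,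
        (cumulativeSpectrum S T (p (k + 1)) ω - cumulativeSpectrum S T (p k) ω)
          * expJ (2 * Real.pi * ξ k * t)
        = quatPair (∑ k ∈ Finset.range n, c k * S (bandL2 μ (p k) (p (k + 1))) ω,
          ∑ k ∈ Finset.range n, c k * T (bandL2 μ (p k) (p (k + 1))) ω) := by
      rw [prod_mk_sum, map_sum]
      refine Finset.sum_congr rfl fun k hk => ?_
      rw [e3 k (Finset.mem_range.1 hk), quatPair_mul_expJ]
    rw [e1, e2, hq, hsum, ← map_sub]
    rfl
  rw [eLpNorm_congr_ae hae]
  refine (eLpNorm_quatPair_le _ _).trans_lt ((ENNReal.ofReal_lt_ofReal_iff hε).2 ?_)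
  calc ‖S r‖ + ‖T r‖ ≤ C * δ + C * δ := add_le_add ((hS r).trans hrn) ((hT r).trans hrn)
    _ = ε * (2 * C / (2 * C + 1)) := by rw [hδ]; ring
    _ < ε := by
      refine mul_lt_of_lt_one_right hε ((div_lt_one (by positivity)).2 (by linarith))

end CumulativeSpectrum

/-! ### The quaternion spectral measure on the line. -/

section SpectralDensity

open AddCircle

variable {μ : Measure UnitAddCircle} [IsFiniteMeasure μ]

/-- The quaternion measure on the line with density `ψ` with respect to `μ`. -/
noncomputable def frequencyMeasure (μ : Measure UnitAddCircle) (ψ : UnitAddCircle → ℍ[ℝ]) :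
    VectorMeasure ℝ ℍ[ℝ] :=
  (μ.map freq).withDensityᵥ fun ν => ψ ν

theorem integrable_map_freq {μ : Measure UnitAddCircle} {ψ : UnitAddCircle → ℍ[ℝ]}
    (hψ : Integrable ψ μ) : Integrable (fun ν : ℝ => ψ ν) (μ.map freq) := by
  rw [measurableEmbedding_freq.integrable_map_iff]
  refine hψ.congr (ae_of_all _ fun z => ?_)
  rw [Function.comp_apply, coe_freq]

theorem frequencyMeasure_apply {μ : Measure UnitAddCircle} {ψ : UnitAddCircle → ℍ[ℝ]}
    (hψ : Integrable ψ μ) {B : Set ℝ} (hB : MeasurableSet B) :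
    frequencyMeasure μ ψ B = ∫ z in freq ⁻¹' B, ψ z ∂μ := by
  rw [frequencyMeasure, withDensityᵥ_apply (integrable_map_freq hψ) hB,
    measurableEmbedding_freq.setIntegral_map]
  simp_rw [coe_freq]

/-- By Radon–Nikodym, the Lebesgue density is `ψ` times the derivative of the image of `μ` under
`freq`. -/
theorem exists_density_frequencyMeasure {ψ : UnitAddCircle → ℍ[ℝ]} (hψ : Integrable ψ μ)
    (hμ : μ ≪ haarAddCircle) :
    ∃ Γ : ℝ → ℍ[ℝ], Integrable Γ ∧
      ∀ B : Set ℝ, MeasurableSet B → frequencyMeasure μ ψ B = ∫ ν in B, Γ ν := by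
  have hac := map_freq_absolutelyContinuous hμ
  refine ⟨fun ν => ((μ.map freq).rnDeriv volume ν).toReal • ψ ν,
    (integrable_rnDeriv_smul_iff hac).2 (integrable_map_freq hψ), fun B hB => ?_⟩
  rw [setIntegral_rnDeriv_smul hac hB, frequencyMeasure,
    withDensityᵥ_apply (integrable_map_freq hψ) hB]

end SpectralDensity

/-! ### The spectral representation theorem. -/

open AddCircle in
theorem theorem1 {Ω : Type*} [MeasurableSpace Ω] (P : Measure Ω) [IsProbabilityMeasure P]
    (u v : ℤ → Ω → ℝ)
    (hstat : JointlyStationary P u v)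
    (hu0 : ∀ t, ∫ ω, u t ω ∂P = 0) (hv0 : ∀ t, ∫ ω, v t ω ∂P = 0)
    (hu : Harmonizable P u) (hv : Harmonizable P v) :
    ∃ (X : ℝ → Ω → ℍ[ℝ]) (G : VectorMeasure ℝ ℍ[ℝ]),
      OrthogonalProcess P X ∧
      -- the spectral representation `x[t] = ∫ dX(ν) exp(j 2 π ν t)` with `x[t] = u[t] + i v[t]`
      (∀ t : ℤ, IsMeanSquareStieltjesIntegral P X (fun ν => expJ (2 * Real.pi * ν * t))
        (fun ω => quatI (u t ω) (v t ω))) ∧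
      -- the increments have zero mean
      (∀ a b : ℝ, -(1 / 2) ≤ a → a ≤ b → b ≤ 1 / 2 → ∫ ω, (X b ω - X a ω) ∂P = 0) ∧
      -- the spectral density, as a quaternion-valued measure `G = Γ(ν) dν`
      (∀ a b : ℝ, -(1 / 2) ≤ a → a ≤ b → b ≤ 1 / 2 →
        ((∫ ω, ‖X b ω - X a ω‖ ^ 2 ∂P : ℝ) : ℍ[ℝ])
          + (∫ ω, (X b ω - X a ω) * starJ (X b ω - X a ω) ∂P) * quatJ = G (Ioc a b)) ∧
      -- it is an integrable function when the auto- and cross-correlations are summable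
      ((Summable fun τ : ℤ => |corrSeq P u u 0 τ|) → (Summable fun τ : ℤ => |corrSeq P v v 0 τ|) →
        (Summable fun τ : ℤ => |corrSeq P u v 0 τ|) →
        ∃ Γ : ℝ → ℍ[ℝ], IntegrableOn Γ (Ioc (-(1 / 2) : ℝ) (1 / 2)) ∧
          ∀ B : Set ℝ, MeasurableSet B → B ⊆ Ioc (-(1 / 2) : ℝ) (1 / 2) →
            G B = ∫ ν in B, Γ ν) ∧
      -- the increments are two times orthogonal
      (∀ a b c d : ℝ, -(1 / 2) ≤ a → a ≤ b → b ≤ 1 / 2 →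
        -(1 / 2) ≤ c → c ≤ d → d ≤ 1 / 2 → (b ≤ c ∨ d ≤ a) →
        ∫ ω, (X b ω - X a ω) * star (X d ω - X c ω) ∂P = 0 ∧
        ∫ ω, (X b ω - X a ω) * starJ (X d ω - X c ω) ∂P = 0) := by
  have hlag : ∀ {y z : ℤ → Ω → ℝ} (hy : ∀ t, MemLp (y t) 2 P) (hz : ∀ t, MemLp (z t) 2 P),
      (∀ s t τ, corrSeq P y z s τ = corrSeq P y z t τ) → ∀ m n,
      inner ℂ (complexL2 (hy m)) (complexL2 (hz n))
        = inner ℂ (complexL2 (hy 0)) (complexL2 (hz (n - m))) := by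
    intro y z hy hz h m n
    -- Lag `m - n` carries time `m` to `n` and time `0` to `n - m`.
    have := h m 0 (m - n)
    simp only [corrSeq, sub_sub_cancel, zero_sub, neg_sub] at this
    rw [inner_complexL2, inner_complexL2, this]
  have huu := hlag hstat.memLp_left hstat.memLp_left hstat.corr_left
  have hvv := hlag hstat.memLp_right hstat.memLp_right hstat.corr_right
  have huv := hlag hstat.memLp_left hstat.memLp_right hstat.corr_cross
  obtain ⟨μ, hfin, S, T, hμ, hS, hT, hSn, hTn⟩ := exists_jointSpectralMaps huu hvv
  obtain ⟨φ₁, hφ₁, hSS⟩ := exists_crossDensity S S (fun m n => by simpa only [hS] using huu m n)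
  obtain ⟨φ₂, hφ₂, hTT⟩ := exists_crossDensity T T (fun m n => by simpa only [hT] using hvv m n)
  obtain ⟨φ, hφ, hST⟩ := exists_crossDensity S T
    (fun m n => by simpa only [hS, hT] using huv m n)
  have hmean : ∀ {y : ℤ → Ω → ℝ} (hy : ∀ t, MemLp (y t) 2 P), (∀ t, ∫ ω, y t ω ∂P = 0) →
      ∀ t, ∫ ω, complexL2 (hy t) ω ∂P = 0 := fun hy h0 t => by
    rw [integral_congr_ae (coeFn_complexL2 (hy t)), integral_complex_ofReal, h0,
      Complex.ofReal_zero]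
  have horth : ∀ a b c d : ℝ, -(1 / 2) ≤ a → a ≤ b → -(1 / 2) ≤ c → c ≤ d → (b ≤ c ∨ d ≤ a) →
      ∫ ω, (cumulativeSpectrum S T b ω - cumulativeSpectrum S T a ω)
        * star (cumulativeSpectrum S T d ω - cumulativeSpectrum S T c ω) ∂P = 0 ∧
      ∫ ω, (cumulativeSpectrum S T b ω - cumulativeSpectrum S T a ω)
        * starJ (cumulativeSpectrum S T d ω - cumulativeSpectrum S T c ω) ∂P = 0 := by
    intro a b c d ha hab hc hcd h
    have hdisj : Disjoint (Ioc a b) (Ioc c d) := by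
      rcases h with h | h
      · exact Ioc_disjoint_Ioc_of_le h
      · exact (Ioc_disjoint_Ioc_of_le h).symm
    have h1 : freq ⁻¹' Ioc a b ∩ freq ⁻¹' Ioc c d = ∅ := (hdisj.preimage freq).inter_eq
    have h2 : freq ⁻¹' Ioc c d ∩ freq ⁻¹' Ioc a b = ∅ := by rw [inter_comm, h1]
    rw [integral_cumulativeSpectrum_sub_mul_star S T ha hab hc hcd,
      integral_cumulativeSpectrum_sub_mul_starJ S T ha hab hc hcd]
    simp only [bandL2, hSS, hTT, hST, h1, h2, Measure.restrict_empty, integral_zero_measure,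
      add_zero, sub_zero]
    exact ⟨map_zero quatPair, map_zero quatPair⟩
  -- On equal bands `E|·|²` has density `φ₁ + φ₂`, and the `starJ` moment has components `φ₁ - φ₂`
  -- and `2φ`; right multiplication by `j` multiplies both of the latter by `Complex.I`.
  let ψ : UnitAddCircle → ℍ[ℝ] := fun z =>
    quatPair ((φ₁ z + φ₂ z) + (φ₁ z - φ₂ z) * Complex.I, (φ z + φ z) * Complex.I)
  have hadd : Integrable (fun z => φ₁ z + φ₂ z) μ := hφ₁.add hφ₂
  have hsub : Integrable (fun z => (φ₁ z - φ₂ z) * Complex.I) μ := (hφ₁.sub hφ₂).mul_const _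
  have hψ₁ : Integrable (fun z => (φ₁ z + φ₂ z) + (φ₁ z - φ₂ z) * Complex.I) μ :=
    hadd.add hsub
  have hψ₂ : Integrable (fun z => (φ z + φ z) * Complex.I) μ := (hφ.add hφ).mul_const _
  have hψ : Integrable ψ μ := quatPair.integrable_comp (hψ₁.prodMk hψ₂)
  refine ⟨cumulativeSpectrum S T, frequencyMeasure μ ψ,
    ⟨fun ν _ => memLp_cumulativeSpectrum S T ν, fun a b c d ha hab _ hc hcd _ h =>
      (horth a b c d ha hab hc hcd h).1⟩, fun t => ?_, fun a b ha hab _ => ?_,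
    fun a b ha hab _ => ?_, fun su sv _ => ?_, fun a b c d ha hab _ hc hcd _ h =>
      horth a b c d ha hab hc hcd h⟩
  · exact isMeanSquareStieltjesIntegral_cumulativeSpectrum S T (hstat.memLp_left t)
      (hstat.memLp_right t) t (hS t) (hT t) hSn hTn
  · refine integral_cumulativeSpectrum_sub_eq_zero S T (fun n => ?_) (fun n => ?_) ha hab
    · rw [hS]; exact hmean hstat.memLp_left hu0 n
    · rw [hT]; exact hmean hstat.memLp_right hv0 n
  · rw [frequencyMeasure_apply hψ measurableSet_Ioc, coe_eq_quatPair,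
      integral_norm_sq_cumulativeSpectrum_sub S T ha hab,
      integral_cumulativeSpectrum_sub_mul_starJ S T ha hab ha hab, quatPair_mul_quatJ, ← map_add,
      integral_quatPair hψ₁.integrableOn hψ₂.integrableOn,
      integral_add hadd.integrableOn hsub.integrableOn,
      integral_mul_const, integral_mul_const, integral_add hφ₁.integrableOn hφ₂.integrableOn,
      integral_sub hφ₁.integrableOn hφ₂.integrableOn,
      integral_add hφ.integrableOn hφ.integrableOn]
    simp only [bandL2, hSS, hTT, hST, inter_self, Prod.mk_add_mk, zero_add]
  · have hneg : ∀ {y : ℤ → Ω → ℝ} (hy : ∀ t, MemLp (y t) 2 P),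
        (Summable fun τ : ℤ => |corrSeq P y y 0 τ|) →
        Summable fun n : ℤ => ‖inner ℂ (complexL2 (hy 0)) (complexL2 (hy n))‖ := by
      intro y hy hs
      -- `corrSeq` at time `0` and lag `τ` pairs time `0` with `-τ`, hence the reflection.
      refine ((Equiv.neg ℤ).summable_iff.2 hs).congr fun n => ?_
      rw [inner_complexL2, Complex.norm_real, Real.norm_eq_abs]
      simp [corrSeq]
    -- The coefficients of `μ` are sums of two autocorrelations, and `G` already has the integrable
    -- density `ψ` relative to the image of `μ`.
    have hac : μ ≪ haarAddCircle := by
      refine absolutelyContinuous_of_summable_fourier μ ?_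
      simp_rw [hμ]
      exact Summable.of_nonneg_of_le (fun _ => norm_nonneg _) (fun _ => norm_add_le _ _)
        ((hneg hstat.memLp_left su).add (hneg hstat.memLp_right sv))
    obtain ⟨Γ, hΓ, hG⟩ := exists_density_frequencyMeasure hψ hac
    exact ⟨Γ, hΓ.integrableOn, fun B hB _ => hG B hB⟩
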